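/- Let $F$ be a division ring, $n$ a natural number, $\sigma\colon F\to F^{n\times n}$ a ring morphism and $\delta\colon F\to F^n$ a $\sigma$-derivation, i.e. an additive map with $\delta(xy)=\sigma(x)\delta(y)+\delta(x)y$. Let $F[\mathbf x;\sigma,\delta]$ be the free multivariate skew polynomial ring: it has the words (monomials) in $x_1,\dots,x_n$ as a left $F$-basis, words are multiplied by appending, and $x_i c=\sum_j\sigma_{i,j}(c)x_j+\delta_i(c)$ for $c\in F$; the degree of a skew polynomial is the maximal length of a word that occurs in it ($\deg 0=-\infty$). For $P\in F[\mathbf x;\sigma,\delta]$ and $\mathbf a\in F^n$, the evaluation $P(\mathbf a)$ is the unique element of $F$ such that $P-P(\mathbf a)$ lies in the left ideal $(x_1-a_1,\dots,x_n-a_n)$. The P-closure $\overline\Omega$ of $\Omega\subseteq F^n$ is the set of common zeros of all skew polynomials that vanish on $\Omega$; $\Omega$ is P-closed if $\overline\Omega=\Omega$, and P-independent if $\mathbf a\notin\overline{\Omega\setminus\{\mathbf a\}}$ for all $\mathbf a\in\Omega$. A P-basis of a P-closed set $\Omega$ is a P-independent subset of $\Omega$ with P-closure $\Omega$; the rank $\mathrm{Rk}(\Omega)$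 is the common size of the finite P-bases of $\Omega$, if there are any. For a finite P-independent set $\mathcal B\subseteq F^n$ with $M$ elements, put $\Omega=\overline{\mathcal B}$. For a skew polynomial $P$ with $\deg P<M$ let $Z_\Omega(P)$ be the set of zeros of $P$ in $\Omega$, and $\mathrm{wt}^{\sigma,\delta}_\Omega(P)=\mathrm{Rk}(\Omega)-\mathrm{Rk}(Z_\Omega(P))$. The skew weight of $f\in F^{\mathcal B}$ is $\mathrm{wt}^{\sigma,\delta}_{\mathcal B}(f)=\mathrm{wt}^{\sigma,\delta}_\Omega(P)$ for any skew polynomial $P$ with $\deg P<M$ and $P(\mathbf b)=f(\mathbf b)$ for all $\mathbf b\in\mathcal B$. For $\mathbf a\in F^n$ and $\beta\in F$ let $\mathcal D_{\mathbf a}(\beta)=\sigma(\beta)\mathbf a+\delta(\beta)\in F^n$; the conjugate of $\mathbf a$ with exponent $\beta\neq0$ is $\mathbf a^\beta=\mathcal D_{\mathbf a}(\beta)\beta^{-1}$, and the centralizer $K_{\mathbf a}=\{\beta\in F\mid\mathcal D_{\mathbf a}(\beta)=\mathbf a\beta\}$ is a division subring of $F$. For words $\mathfrak m$ let $\mathcal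 D_{\mathbf a}^{1}=\mathrm{id}$ and let $\mathcal D_{\mathbf a}^{x_i\mathfrak m}(\beta)$ be the $i$-th entry of $\mathcal D_{\mathbf a}(\mathcal D_{\mathbf a}^{\mathfrak m}(\beta))$; for $P=\sum_{\mathfrak m}P_{\mathfrak m}\mathfrak m$ put $P^{\mathcal D_{\mathbf a}}(\beta)=\sum_{\mathfrak m}P_{\mathfrak m}\mathcal D_{\mathbf a}^{\mathfrak m}(\beta)$. For division subrings $K_1,\dots,K_\ell$ of $F$, lengths $M_1,\dots,M_\ell$ and $M=M_1+\dots+M_\ell$, the sum-rank weight of $\mathbf c=(c^{(i)}_j)\in F^M$ is $\mathrm{wt}_{SR}(\mathbf c)=\sum_{i=1}^\ell\dim_{K_i}\langle c^{(i)}_1,\dots,c^{(i)}_{M_i}\rangle^R_{K_i}$, where $\langle\cdot\rangle^R_{K_i}$ denotes the right $K_i$-linear span. **Theorem.** Let $\mathbf a_1,\dots,\mathbf a_\ell\in F^n$ be pairwise non-conjugate, let $\beta^{(i)}_j\in F\setminus\{0\}$ for $1\le j\le M_i$, $1\le i\le\ell$, and put $\mathbf b^{(i)}_j=\mathbf a_i^{\beta^{(i)}_j}$.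 Suppose that the $M=M_1+\dots+M_\ell$ points $\mathbf b^{(i)}_j$ are distinct and that $\mathcal B=\{\mathbf b^{(i)}_j\}$ is P-independent, hence a P-basis of $\Omega=\overline{\mathcal B}$. Let $\mathrm{wt}_{SR}$ be the sum-rank weight with lengths $(M_1,\dots,M_\ell)$ and division subrings $(K_{\mathbf a_1},\dots,K_{\mathbf a_\ell})$. Then: 1. For every $f\in F^{\mathcal B}$, the skew weight $\mathrm{wt}^{\sigma,\delta}_{\mathcal B}(f)$ is well defined (there is a $P$ of degree less than $M$ with values $f$ on $\mathcal B$, and for all such $P$ the set $Z_\Omega(P)$ has a finite P-basis and $\mathrm{wt}^{\sigma,\delta}_\Omega(P)$ is the same number), and $$\mathrm{wt}^{\sigma,\delta}_{\mathcal B}(f)=\mathrm{wt}_{SR}(\mathbf c),\qquad\text{where } c^{(i)}_j=f(\mathbf b^{(i)}_j)\,\beta^{(i)}_j .$$ 2. For every $d\ge0$, the same scaling $(c^{(i)}_j)\mapsto(c^{(i)}_j\beta^{(i)}_j)$ of $F^M$ maps the skew Reed–Muller code $\{(P(\mathbf b^{(i)}_j))_{i,j}\mid\deg P<d\}$ onto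 the linearized Reed–Muller code $\{(P^{\mathcal D_{\mathbf a_i}}(\beta^{(i)}_j))_{i,j}\mid\deg P<d\}$. -/

import Mathlib

/-- A `σ`-derivation `δ : F → Fⁿ` for a ring morphism `σ : F → F^{n × n}`: an additive map with
`δ (a b) = σ(a) δ(b) + δ(a) b`. -/
structure SkewDerivation {F : Type*} [DivisionRing F] {n : ℕ}
    (σ : F →+* Matrix (Fin n) (Fin n) F) extends F →+ (Fin n → F) where
  leibniz' : ∀ x y : F, toFun (x * y) = Matrix.mulVec (σ x) (toFun y) + fun i => toFun x i * y

/-- The underlying left vector space of the free multivariate skew polynomial ring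
`F[x; σ, δ]`: it has the monomials (words in the letters `x₁, …, xₙ`) as a left basis. -/
def SkewPoly {F : Type*} [DivisionRing F] {n : ℕ}
    (σ : F →+* Matrix (Fin n) (Fin n) F) (_δ : SkewDerivation σ) : Type _ :=
  FreeMonoid (Fin n) →₀ F

namespace SkewPoly

section Ring

variable {F : Type*} [DivisionRing F] {n : ℕ}
  {σ : F →+* Matrix (Fin n) (Fin n) F} {δ : SkewDerivation σ}

noncomputable instance instAddCommGroup : AddCommGroup (SkewPoly σ δ) :=
  inferInstanceAs (AddCommGroup (FreeMonoid (Fin n) →₀ F))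

noncomputable instance instModule : Module F (SkewPoly σ δ) :=
  inferInstanceAs (Module F (FreeMonoid (Fin n) →₀ F))

/-- The coefficient of the monomial `m`. -/
def coeff (P : SkewPoly σ δ) (m : FreeMonoid (Fin n)) : F :=
  (show FreeMonoid (Fin n) →₀ F from P) m

/-- The monomials that occur in `P` (those with a non-zero coefficient). -/
def support (P : SkewPoly σ δ) : Finset (FreeMonoid (Fin n)) :=
  Finsupp.support (show FreeMonoid (Fin n) →₀ F from P)

/-- The skew polynomial `c m` for a constant `c` and a monomial `m`, additively in `c`. -/
noncomputable def monomial (m : FreeMonoid (Fin n)) : F →+ SkewPoly σ δ :=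
  Finsupp.singleAddHom m

/-- Left linear extension of a map on monomials. -/
noncomputable def lsum {V : Type*} [AddCommGroup V] [Module F V] (P : SkewPoly σ δ)
    (g : FreeMonoid (Fin n) → V) : V :=
  P.support.sum fun m => P.coeff m • g m

/-- The degree of `P`: the maximal length of a monomial of `P`, and `⊥` (i.e. `-∞`) for `P = 0`. -/
def degree (P : SkewPoly σ δ) : WithBot ℕ :=
  P.support.sup fun m => ((FreeMonoid.length m : ℕ) : WithBot ℕ)

theorem hom_ext {V : Type*} [AddCommGroup V] {f g : SkewPoly σ δ →+ V}
    (h : ∀ m c, f (monomial m c) = g (monomial m c)) : f = g :=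
  Finsupp.addHom_ext h

theorem smul_monomial (c : F) (m : FreeMonoid (Fin n)) (d : F) :
    c • (monomial m d : SkewPoly σ δ) = monomial m (c * d) :=
  Finsupp.smul_single c m d

theorem lsum_monomial {V : Type*} [AddCommGroup V] [Module F V] (m : FreeMonoid (Fin n)) (c : F)
    (g : FreeMonoid (Fin n) → V) : lsum (monomial m c : SkewPoly σ δ) g = c • g m :=
  Finsupp.sum_single_index (h := fun m c => c • g m) (zero_smul F (g m))

theorem lsum_add {V : Type*} [AddCommGroup V] [Module F V] (P Q : SkewPoly σ δ)
    (g : FreeMonoid (Fin n) → V) : lsum (P + Q) g = lsum P g + lsum Q g :=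
  Finsupp.sum_add_index' (h := fun m c => c • g m) (fun m => zero_smul F (g m))
    (fun m _ _ => add_smul _ _ (g m))

theorem lsum_smul {V : Type*} [AddCommGroup V] [Module F V] (c : F) (P : SkewPoly σ δ)
    (g : FreeMonoid (Fin n) → V) : lsum (c • P) g = c • lsum P g := by
  refine (Finsupp.sum_smul_index (h := fun m c => c • g m) (fun m => zero_smul F (g m))).trans ?_
  simp only [mul_smul]
  exact (Finset.smul_sum).symm

theorem lsum_one (P : SkewPoly σ δ) : lsum P (fun m => (monomial m 1 : SkewPoly σ δ)) = P := by
  simp only [lsum, smul_monomial, mul_one]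
  exact Finsupp.sum_single (show FreeMonoid (Fin n) →₀ F from P)

/-- `lsum` as a left linear map. -/
noncomputable def lsumHom {V : Type*} [AddCommGroup V] [Module F V]
    (g : FreeMonoid (Fin n) → V) : SkewPoly σ δ →ₗ[F] V where
  toFun P := lsum P g
  map_add' P Q := lsum_add P Q g
  map_smul' c P := lsum_smul c P g

/-- Left multiplication by the variable `xᵢ`, as forced by the rule
`xᵢ c = ∑ⱼ σᵢⱼ(c) xⱼ + δᵢ(c)` and by appending of monomials:
`xᵢ (c m) = ∑ⱼ σᵢⱼ(c) (xⱼ m) + δᵢ(c) m`. -/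
noncomputable def varOp (i : Fin n) : SkewPoly σ δ →+ SkewPoly σ δ :=
  Finsupp.liftAddHom fun m =>
    ((Finset.univ.sum fun j => (monomial (FreeMonoid.of j * m)).comp
        (((Pi.evalAddMonoidHom (fun _ : Fin n => F) j).comp
          (Pi.evalAddMonoidHom (fun _ : Fin n => Fin n → F) i)).comp
            (σ : F →+ Matrix (Fin n) (Fin n) F))) +
      (monomial m).comp ((Pi.evalAddMonoidHom (fun _ : Fin n => F) i).comp δ.toAddMonoidHom) :
      F →+ SkewPoly σ δ)

theorem varOp_monomial (i : Fin n) (m : FreeMonoid (Fin n)) (c : F) :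
    varOp i (monomial m c : SkewPoly σ δ) =
      (∑ j, monomial (FreeMonoid.of j * m) (σ c i j)) + monomial m (δ.toAddMonoidHom c i) := by
  refine (Finsupp.liftAddHom_apply_single _ m c).trans ?_
  simp only [AddMonoidHom.add_apply, AddMonoidHom.finsetSum_apply]
  rfl

/-- Left multiplication by a monomial. -/
noncomputable def wordOp : FreeMonoid (Fin n) →* AddMonoid.End (SkewPoly σ δ) :=
  FreeMonoid.lift varOp

/-- The product of the free skew polynomial ring: `(∑ₘ Pₘ m) Q = ∑ₘ Pₘ (m Q)`. -/
noncomputable instance instMul : Mul (SkewPoly σ δ) :=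
  ⟨fun P Q => lsum P fun m => wordOp m Q⟩

noncomputable instance instOne : One (SkewPoly σ δ) := ⟨monomial 1 1⟩

theorem mul_def (P Q : SkewPoly σ δ) : P * Q = lsum P fun m => wordOp m Q := rfl

theorem one_def : (1 : SkewPoly σ δ) = monomial 1 1 := rfl

theorem derivation_mul (x y : F) (i : Fin n) : δ.toAddMonoidHom (x * y) i =
    (∑ j, σ x i j * δ.toAddMonoidHom y j) + δ.toAddMonoidHom x i * y :=
  congrFun (δ.leibniz' x y) i

theorem derivation_one : δ.toAddMonoidHom 1 = 0 := by
  funext i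
  have h := derivation_mul (δ := δ) 1 1 i
  simpa [Matrix.one_apply] using h

theorem varOp_smul (i : Fin n) (c : F) (Q : SkewPoly σ δ) :
    varOp i (c • Q) = (∑ j, σ c i j • varOp j Q) + δ.toAddMonoidHom c i • Q := by
  have key : (varOp i).comp (DistribSMul.toAddMonoidHom (SkewPoly σ δ) c) =
      (∑ j, (DistribSMul.toAddMonoidHom (SkewPoly σ δ) (σ c i j)).comp (varOp j)) +
        DistribSMul.toAddMonoidHom (SkewPoly σ δ) (δ.toAddMonoidHom c i) := by
    refine hom_ext fun m d => ?_
    simp only [AddMonoidHom.comp_apply, DistribSMul.toAddMonoidHom_apply, AddMonoidHom.add_apply,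
      AddMonoidHom.finsetSum_apply, smul_monomial, varOp_monomial,
      derivation_mul, map_add, map_sum, map_mul, Matrix.mul_apply, Finset.sum_add_distrib]
    rw [Finset.sum_comm, add_assoc]
  have h := DFunLike.congr_fun key Q
  simpa only [AddMonoidHom.comp_apply, DistribSMul.toAddMonoidHom_apply, AddMonoidHom.add_apply,
      AddMonoidHom.finsetSum_apply] using h

theorem wordOp_cons (i : Fin n) (m : FreeMonoid (Fin n)) (Q : SkewPoly σ δ) :
    wordOp (FreeMonoid.of i * m) Q = varOp i (wordOp m Q) := by
  simp only [wordOp, map_mul]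
  rfl

theorem wordOp_one (Q : SkewPoly σ δ) : wordOp 1 Q = Q := by
  simp only [map_one]
  rfl

theorem monomial_mul (m : FreeMonoid (Fin n)) (c : F) (Q : SkewPoly σ δ) :
    monomial m c * Q = c • wordOp m Q :=
  lsum_monomial m c _

theorem add_mul' (P Q R : SkewPoly σ δ) : (P + Q) * R = P * R + Q * R := lsum_add P Q _

theorem smul_mul' (c : F) (P R : SkewPoly σ δ) : (c • P) * R = c • (P * R) := lsum_smul c P _

theorem mul_add' (P Q R : SkewPoly σ δ) : P * (Q + R) = P * Q + P * R := by
  simp only [mul_def, lsum, map_add, smul_add, Finset.sum_add_distrib]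

/-- Right multiplication as an additive map. -/
noncomputable def mulRightHom (R : SkewPoly σ δ) : SkewPoly σ δ →+ SkewPoly σ δ where
  toFun P := P * R
  map_zero' := by simpa using smul_mul' (0 : F) 0 R
  map_add' P Q := add_mul' P Q R

theorem varOp_mul (i : Fin n) (Q R : SkewPoly σ δ) : varOp i Q * R = varOp i (Q * R) := by
  have key : (mulRightHom R).comp (varOp i) = (varOp i).comp (mulRightHom R) := by
    refine hom_ext fun m c => ?_
    simp only [AddMonoidHom.comp_apply, varOp_monomial, map_add, map_sum]
    simp only [mulRightHom, AddMonoidHom.coe_mk, ZeroHom.coe_mk, monomial_mul, wordOp_cons,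
      varOp_smul]
  exact DFunLike.congr_fun key Q

theorem wordOp_mul (m : FreeMonoid (Fin n)) (Q R : SkewPoly σ δ) :
    wordOp m Q * R = wordOp m (Q * R) := by
  induction m using FreeMonoid.inductionOn' with
  | one => simp only [wordOp_one]
  | of_mul i m ih => rw [wordOp_cons, wordOp_cons, varOp_mul, ih]

theorem mul_assoc' (P Q R : SkewPoly σ δ) : P * Q * R = P * (Q * R) := by
  have key : (mulRightHom R).comp (mulRightHom Q) = mulRightHom (Q * R) := by
    refine hom_ext fun m c => ?_
    simp only [AddMonoidHom.comp_apply, mulRightHom, AddMonoidHom.coe_mk, ZeroHom.coe_mk,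
      monomial_mul, smul_mul', wordOp_mul]
  exact DFunLike.congr_fun key P

theorem one_mul' (Q : SkewPoly σ δ) : 1 * Q = Q := by
  rw [one_def, monomial_mul, wordOp_one, one_smul]

theorem varOp_monomial_one (i : Fin n) (m : FreeMonoid (Fin n)) :
    varOp i (monomial m 1 : SkewPoly σ δ) = monomial (FreeMonoid.of i * m) 1 := by
  rw [varOp_monomial, derivation_one]
  simp only [map_one, Matrix.one_apply, Pi.zero_apply, map_zero, add_zero]
  rw [Finset.sum_eq_single i]
  · simp
  · intro j _ hj
    simp [Ne.symm hj]
  · simp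

theorem wordOp_monomial_one (m k : FreeMonoid (Fin n)) :
    wordOp m (monomial k 1 : SkewPoly σ δ) = monomial (m * k) 1 := by
  induction m using FreeMonoid.inductionOn' with
  | one => rw [wordOp_one, one_mul]
  | of_mul i m ih => rw [wordOp_cons, ih, varOp_monomial_one, mul_assoc]

theorem mul_one' (P : SkewPoly σ δ) : P * 1 = P := by
  simp only [mul_def, one_def, wordOp_monomial_one, mul_one]
  exact lsum_one P

/-- The free multivariate skew polynomial ring `F[x; σ, δ]`. -/
noncomputable instance instRing : Ring (SkewPoly σ δ) :=
  { instAddCommGroup with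
    mul := fun P Q => P * Q
    one := 1
    mul_assoc := mul_assoc'
    one_mul := one_mul'
    mul_one := mul_one'
    left_distrib := mul_add'
    right_distrib := add_mul'
    zero_mul := fun Q => (mulRightHom Q).map_zero
    mul_zero := fun P => by
      have h := mul_add' P 0 0
      rw [add_zero] at h
      exact left_eq_add.mp h }

/-- The constant `c`. -/
noncomputable def C (c : F) : SkewPoly σ δ := monomial 1 c

/-- The variable `xᵢ`. -/
noncomputable def X (i : Fin n) : SkewPoly σ δ := monomial (FreeMonoid.of i) 1

theorem C_mul (c : F) (P : SkewPoly σ δ) : C c * P = c • P := by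
  rw [C, monomial_mul, wordOp_one]

theorem X_mul (i : Fin n) (P : SkewPoly σ δ) : X i * P = varOp i P := by
  rw [X, monomial_mul, one_smul]
  have h := wordOp_cons (σ := σ) (δ := δ) i 1 P
  rwa [mul_one, wordOp_one] at h

/-- The rule that defines the product: `xᵢ c = ∑ⱼ σᵢⱼ(c) xⱼ + δᵢ(c)`. -/
theorem X_mul_C (i : Fin n) (c : F) :
    (X i * C c : SkewPoly σ δ) =
      (∑ j, (C (σ c i j) * X j : SkewPoly σ δ)) + (C (δ.toAddMonoidHom c i) : SkewPoly σ δ) := by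
  simp only [X_mul, C_mul]
  simp only [C, X, varOp_monomial, smul_monomial, mul_one]

/-- Monomials multiply by appending. -/
theorem monomial_one_mul_monomial_one (m k : FreeMonoid (Fin n)) :
    (monomial m 1 * monomial k 1 : SkewPoly σ δ) = monomial (m * k) 1 := by
  rw [monomial_mul, wordOp_monomial_one, one_smul]

end Ring

section Evaluation

variable {F : Type*} [DivisionRing F] {n : ℕ}
  (σ : F →+* Matrix (Fin n) (Fin n) F) (δ : SkewDerivation σ)

/-- The operator `D_a(β) = σ(β) a + δ(β)`. -/
def opD (a : Fin n → F) (β : F) : Fin n → F :=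
  Matrix.mulVec (σ β) a + δ.toAddMonoidHom β

/-- The operators `D_a^m` for monomials `m`: `D_a^1 = id` and `D_a^{xᵢ m} = (D_a ∘ D_a^m)ᵢ`. -/
def opWord (a : Fin n → F) (m : FreeMonoid (Fin n)) (β : F) : F :=
  (FreeMonoid.toList m).foldr (fun i c => opD σ δ a c i) β

variable {σ δ}

/-- The linearized evaluation `P^{D_a}(β) = ∑ₘ Pₘ D_a^m(β)`. -/
noncomputable def linEval (P : SkewPoly σ δ) (a : Fin n → F) (β : F) : F :=
  lsum P fun m => opWord σ δ a m β

/-- The left ideal `(x₁ - a₁, …, xₙ - aₙ)`. -/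
noncomputable def pointIdeal (σ : F →+* Matrix (Fin n) (Fin n) F) (δ : SkewDerivation σ)
    (a : Fin n → F) : Ideal (SkewPoly σ δ) :=
  Ideal.span (Set.range fun i => (X i - C (a i) : SkewPoly σ δ))

theorem opD_apply (a : Fin n → F) (β : F) (i : Fin n) :
    opD σ δ a β i = (∑ j, σ β i j * a j) + δ.toAddMonoidHom β i := rfl

theorem opD_add (a : Fin n → F) (β γ : F) (i : Fin n) :
    opD σ δ a (β + γ) i = opD σ δ a β i + opD σ δ a γ i := by
  simp only [opD_apply, map_add, Matrix.add_apply, add_mul, Finset.sum_add_distrib, Pi.add_apply]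
  abel

theorem opD_mul (a : Fin n → F) (β γ : F) (i : Fin n) :
    opD σ δ a (β * γ) i =
      (∑ j, σ β i j * opD σ δ a γ j) + δ.toAddMonoidHom β i * γ := by
  simp only [opD_apply, map_mul, Matrix.mul_apply, derivation_mul, mul_add, Finset.sum_add_distrib,
    Finset.sum_mul, Finset.mul_sum, mul_assoc]
  rw [Finset.sum_comm, add_assoc]

theorem opWord_cons (a : Fin n → F) (i : Fin n) (m : FreeMonoid (Fin n)) (β : F) :
    opWord σ δ a (FreeMonoid.of i * m) β = opD σ δ a (opWord σ δ a m β) i := rfl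

theorem opD_linEval (P : SkewPoly σ δ) (a : Fin n → F) (β : F) (i : Fin n) :
    linEval (varOp i P) a β = opD σ δ a (linEval P a β) i := by
  let L : SkewPoly σ δ →+ F :=
    (lsumHom (σ := σ) (δ := δ) fun m => opWord σ δ a m β).toAddMonoidHom
  let Di : F →+ F := AddMonoidHom.mk' (fun c => opD σ δ a c i) fun x y => opD_add a x y i
  have key : L.comp (varOp i) = Di.comp L := by
    refine hom_ext fun m c => ?_
    have hL : ∀ k d, L (monomial k d) = d * opWord σ δ a k β := fun k d => lsum_monomial k d _
    simp only [AddMonoidHom.comp_apply, varOp_monomial, map_add, map_sum, hL]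
    exact (opD_mul a c (opWord σ δ a m β) i).symm
  exact DFunLike.congr_fun key P

theorem linEval_add (P Q : SkewPoly σ δ) (a : Fin n → F) (β : F) :
    linEval (P + Q) a β = linEval P a β + linEval Q a β := lsum_add P Q _

theorem linEval_smul (c : F) (P : SkewPoly σ δ) (a : Fin n → F) (β : F) :
    linEval (c • P) a β = c * linEval P a β := lsum_smul c P _

theorem linEval_monomial (m : FreeMonoid (Fin n)) (c : F) (a : Fin n → F) (β : F) :
    linEval (monomial m c : SkewPoly σ δ) a β = c * opWord σ δ a m β := lsum_monomial m c _

theorem linEval_wordOp (m : FreeMonoid (Fin n)) (P : SkewPoly σ δ) (a : Fin n → F) (β : F) :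
    linEval (wordOp m P) a β = opWord σ δ a m (linEval P a β) := by
  induction m using FreeMonoid.inductionOn' with
  | one => rw [wordOp_one]; rfl
  | of_mul i m ih => rw [wordOp_cons, opD_linEval, ih, opWord_cons]

theorem linEval_mul (P Q : SkewPoly σ δ) (a : Fin n → F) (β : F) :
    linEval (P * Q) a β = linEval P a (linEval Q a β) := by
  have h : (lsumHom (σ := σ) (δ := δ) fun m => opWord σ δ a m β) (P * Q) =
      linEval P a (linEval Q a β) := by
    rw [mul_def, lsum, map_sum]
    refine Finset.sum_congr rfl fun m _ => ?_
    rw [map_smul]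
    exact congrArg _ (linEval_wordOp m Q a β)
  exact h

theorem linEval_C (c : F) (a : Fin n → F) (β : F) :
    linEval (C c : SkewPoly σ δ) a β = c * β := linEval_monomial 1 c a β

theorem opD_one (a : Fin n → F) (i : Fin n) : opD σ δ a 1 i = a i := by
  rw [opD_apply, derivation_one]
  simp [Matrix.one_apply]

theorem linEval_zero_right (P : SkewPoly σ δ) (a : Fin n → F) : linEval P a 0 = 0 := by
  have h := linEval_mul P 0 a 1
  have h0 : linEval (0 : SkewPoly σ δ) a 1 = 0 := by
    simpa using linEval_smul (0 : F) (0 : SkewPoly σ δ) a 1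
  rwa [mul_zero, h0, eq_comm] at h

theorem linEval_one_eq_zero_of_mem {a : Fin n → F} {P : SkewPoly σ δ}
    (hP : P ∈ pointIdeal σ δ a) : linEval P a 1 = 0 := by
  induction hP using Submodule.span_induction with
  | mem P hP =>
    obtain ⟨i, rfl⟩ := hP
    have h : linEval (X i - C (a i) : SkewPoly σ δ) a 1 + linEval (C (a i) : SkewPoly σ δ) a 1 =
        linEval (X i : SkewPoly σ δ) a 1 := by
      rw [← linEval_add, sub_add_cancel]
    have hX : linEval (X i : SkewPoly σ δ) a 1 = a i := by
      rw [X, linEval_monomial, one_mul]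
      exact opD_one a i
    rw [hX, linEval_C, mul_one] at h
    exact add_eq_right.mp h
  | zero => simpa using linEval_smul (0 : F) (0 : SkewPoly σ δ) a 1
  | add P Q _ _ hP hQ => rw [linEval_add, hP, hQ, add_zero]
  | smul R P _ hP => rw [smul_eq_mul, linEval_mul, hP, linEval_zero_right]

theorem C_add (c d : F) : (C (c + d) : SkewPoly σ δ) = C c + C d := map_add (monomial 1) c d

theorem C_mul_C (c d : F) : (C c * C d : SkewPoly σ δ) = C (c * d) := by
  rw [C_mul, C, smul_monomial]; rfl

theorem sub_C_linEval_mem (P : SkewPoly σ δ) (a : Fin n → F) :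
    P - C (linEval P a 1) ∈ pointIdeal σ δ a := by
  have hword : ∀ m : FreeMonoid (Fin n),
      (monomial m 1 - C (opWord σ δ a m 1) : SkewPoly σ δ) ∈ pointIdeal σ δ a := by
    intro m
    induction m using FreeMonoid.inductionOn' with
    | one =>
      have : (monomial 1 1 - C (opWord σ δ a 1 1) : SkewPoly σ δ) = 0 := sub_self _
      rw [this]
      exact zero_mem _
    | of_mul i m ih =>
      have h1 := (pointIdeal σ δ a).mul_mem_left (X i) ih
      set c := opWord σ δ a m 1
      have h2 : (∑ j, C (σ c i j) * (X j - C (a j)) : SkewPoly σ δ) ∈ pointIdeal σ δ a :=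
        Submodule.sum_mem _ fun j _ =>
          (pointIdeal σ δ a).mul_mem_left _ (Ideal.subset_span ⟨j, rfl⟩)
      have h3 := add_mem h1 h2
      have hsum : (C (∑ j, σ c i j * a j) : SkewPoly σ δ) = ∑ j, C (σ c i j * a j) :=
        map_sum (monomial 1) _ _
      have e : (X i * (monomial m 1 - C c) : SkewPoly σ δ) +
          (∑ j, (C (σ c i j) * (X j - C (a j)) : SkewPoly σ δ)) =
          monomial (FreeMonoid.of i * m) 1 - C (opWord σ δ a (FreeMonoid.of i * m) 1) := by
        rw [opWord_cons, opD_apply, C_add, hsum]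
        simp only [mul_sub, X_mul_C, Finset.sum_sub_distrib, C_mul_C]
        rw [X_mul, varOp_monomial_one]
        abel
      rwa [e] at h3
  have h : (∑ m ∈ P.support, C (P.coeff m) * (monomial m 1 - C (opWord σ δ a m 1)) :
      SkewPoly σ δ) ∈ pointIdeal σ δ a :=
    Submodule.sum_mem _ fun m _ => (pointIdeal σ δ a).mul_mem_left _ (hword m)
  have e : (∑ m ∈ P.support, C (P.coeff m) * (monomial m 1 - C (opWord σ δ a m 1)) :
      SkewPoly σ δ) = P - C (linEval P a 1) := by
    simp only [mul_sub, Finset.sum_sub_distrib, C_mul_C]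
    simp only [C_mul]
    congr 1
    · exact lsum_one P
    · exact (map_sum (monomial 1) _ _).symm
  rwa [e] at h

/-- The evaluation is well defined. -/
theorem existsUnique_eval (P : SkewPoly σ δ) (a : Fin n → F) :
    ∃! c : F, P - C c ∈ pointIdeal σ δ a := by
  refine ⟨linEval P a 1, sub_C_linEval_mem P a, fun c hc => ?_⟩
  have h := linEval_add (P - C c) (C c) a 1
  rw [sub_add_cancel, linEval_one_eq_zero_of_mem hc, linEval_C, mul_one, zero_add] at h
  exact h.symm

/-- The (skew) evaluation `P(a)`: the unique `c ∈ F` with `P - c ∈ (x₁ - a₁, …, xₙ - aₙ)`. -/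
noncomputable def eval (P : SkewPoly σ δ) (a : Fin n → F) : F :=
  (existsUnique_eval P a).choose

theorem eval_eq_linEval_one (P : SkewPoly σ δ) (a : Fin n → F) : eval P a = linEval P a 1 :=
  (existsUnique_eval P a).unique (existsUnique_eval P a).choose_spec.1 (sub_C_linEval_mem P a)

/-- The skew evaluation map `P ↦ (P(b))_{b ∈ B}` over `B`, as a left linear map. -/
noncomputable def evalOn (σ : F →+* Matrix (Fin n) (Fin n) F) (δ : SkewDerivation σ)
    (B : Set (Fin n → F)) : SkewPoly σ δ →ₗ[F] (B → F) where
  toFun P b := eval P b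
  map_add' P Q := by
    funext b
    simp only [eval_eq_linEval_one, linEval_add, Pi.add_apply]
  map_smul' c P := by
    funext b
    simp only [eval_eq_linEval_one, linEval_smul, Pi.smul_apply, smul_eq_mul, RingHom.id_apply]

end Evaluation

end SkewPoly

section PClosed

variable {F : Type*} [DivisionRing F] {n : ℕ}
  (σ : F →+* Matrix (Fin n) (Fin n) F) (δ : SkewDerivation σ)

/-- The set of common zeros of a set of skew polynomials. -/
def zeroSet (A : Set (SkewPoly σ δ)) : Set (Fin n → F) :=
  {a | ∀ P ∈ A, SkewPoly.eval P a = 0}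

/-- The skew polynomials that vanish on `Ω`. -/
def vanishing (Ω : Set (Fin n → F)) : Set (SkewPoly σ δ) :=
  {P | ∀ a ∈ Ω, SkewPoly.eval P a = 0}

/-- The P-closure of a set of points. -/
def pClosure (Ω : Set (Fin n → F)) : Set (Fin n → F) :=
  zeroSet σ δ (vanishing σ δ Ω)

/-- `Ω` is P-independent: no point of `Ω` lies in the P-closure of the other ones. -/
def PIndependent (Ω : Set (Fin n → F)) : Prop :=
  ∀ a ∈ Ω, a ∉ pClosure σ δ (Ω \ {a})

/-- `B` is a P-basis of the (automatically P-closed) set `Ω`: a P-independent subset of `Ω` with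
P-closure `Ω`. -/
def IsPBasis (B Ω : Set (Fin n → F)) : Prop :=
  B ⊆ Ω ∧ PIndependent σ δ B ∧ pClosure σ δ B = Ω

/-- The rank of a finitely generated P-closed set `Ω`: the number of elements of any of its finite
P-bases (see `pRank_eq`). -/
noncomputable def pRank (Ω : Set (Fin n → F)) : ℕ :=
  sInf {k | ∃ A : Finset (Fin n → F), IsPBasis σ δ (A : Set (Fin n → F)) Ω ∧ A.card = k}

variable {σ δ}

theorem evalOn_ker {B Ω : Set (Fin n → F)} (h : IsPBasis σ δ B Ω) (P : SkewPoly σ δ) :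
    P ∈ LinearMap.ker (SkewPoly.evalOn σ δ B) ↔ P ∈ vanishing σ δ Ω := by
  rw [LinearMap.mem_ker]
  constructor
  · intro hP a ha
    rw [← h.2.2] at ha
    exact ha P fun b hb => congrFun hP ⟨b, hb⟩
  · intro hP
    funext b
    exact hP b (h.1 b.2)

theorem evalOn_surjective {A : Finset (Fin n → F)}
    (h : PIndependent σ δ (A : Set (Fin n → F))) :
    Function.Surjective (SkewPoly.evalOn σ δ (A : Set (Fin n → F))) := by
  classical
  have hdual : ∀ a : (A : Set (Fin n → F)), ∃ P : SkewPoly σ δ,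
      SkewPoly.evalOn σ δ (A : Set (Fin n → F)) P = Pi.single a 1 := by
    intro a
    have ha := h a a.2
    simp only [pClosure, zeroSet, Set.mem_ofPred_eq, not_forall] at ha
    obtain ⟨P, hP, hPa⟩ := ha
    refine ⟨(SkewPoly.eval P a)⁻¹ • P, ?_⟩
    rw [map_smul]
    funext b
    by_cases hb : b = a
    · subst hb
      rw [Pi.single_eq_same]
      exact inv_mul_cancel₀ hPa
    · rw [Pi.single_eq_of_ne hb]
      have : SkewPoly.eval P b = 0 := hP b ⟨b.2, fun e => hb (Subtype.ext e)⟩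
      change _ * SkewPoly.eval P b = 0
      rw [this, mul_zero]
  choose D hD using hdual
  intro f
  refine ⟨∑ a, f a • D a, ?_⟩
  rw [map_sum]
  funext b
  simp only [map_smul, hD, Finset.sum_apply, Pi.smul_apply, smul_eq_mul, Pi.single_apply,
    mul_ite, mul_one, mul_zero, Finset.sum_ite_eq, Finset.mem_univ, if_true]

/-- Two finite P-bases of the same set have the same number of elements. -/
theorem IsPBasis.card_eq {A A' : Finset (Fin n → F)} {Ω : Set (Fin n → F)}
    (h : IsPBasis σ δ (A : Set (Fin n → F)) Ω) (h' : IsPBasis σ δ (A' : Set (Fin n → F)) Ω) :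
    A.card = A'.card := by
  have hk : LinearMap.ker (SkewPoly.evalOn σ δ (A : Set (Fin n → F))) =
      LinearMap.ker (SkewPoly.evalOn σ δ (A' : Set (Fin n → F))) := by
    ext P
    rw [evalOn_ker h, evalOn_ker h']
  have e1 := (LinearMap.quotKerEquivOfSurjective _ (evalOn_surjective h.2.1)).finrank_eq
  have e2 := (LinearMap.quotKerEquivOfSurjective _ (evalOn_surjective h'.2.1)).finrank_eq
  rw [hk, e2] at e1
  rw [Module.finrank_fintype_fun_eq_card, Module.finrank_fintype_fun_eq_card] at e1
  simpa using e1.symm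

theorem pRank_eq {A : Finset (Fin n → F)} {Ω : Set (Fin n → F)}
    (h : IsPBasis σ δ (A : Set (Fin n → F)) Ω) : pRank σ δ Ω = A.card := by
  have : {k | ∃ A : Finset (Fin n → F), IsPBasis σ δ (A : Set (Fin n → F)) Ω ∧ A.card = k} =
      {A.card} := by
    ext k
    constructor
    · rintro ⟨A', hA', rfl⟩
      exact hA'.card_eq h
    · rintro rfl
      exact ⟨A, h, rfl⟩
  rw [pRank, this, csInf_singleton]

end PClosed

section Conjugacy

variable {F : Type*} [DivisionRing F] {n : ℕ}
  (σ : F →+* Matrix (Fin n) (Fin n) F) (δ : SkewDerivation σ)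

/-- The conjugate `a^β = D_a(β) β⁻¹` of `a` with exponent `β` (used for `β ≠ 0`). -/
def conjugate (a : Fin n → F) (β : F) : Fin n → F :=
  fun i => SkewPoly.opD σ δ a β i * β⁻¹

/-- `b` is conjugate to `a`. -/
def IsConjugate (a b : Fin n → F) : Prop :=
  ∃ β : F, β ≠ 0 ∧ b = conjugate σ δ a β

/-- The centralizer `K_a = {β | D_a(β) = a β}`, a division subring of `F`. -/
def centralizerAt (a : Fin n → F) : Subfield F where
  carrier := {β | SkewPoly.opD σ δ a β = fun i => a i * β}
  zero_mem' := by
    funext i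
    simp [SkewPoly.opD_apply]
  one_mem' := by
    funext i
    rw [SkewPoly.opD_one, mul_one]
  add_mem' := by
    intro x y hx hy
    funext i
    rw [SkewPoly.opD_add, congrFun hx i, congrFun hy i, mul_add]
  neg_mem' := by
    intro x hx
    funext i
    have h := SkewPoly.opD_add (σ := σ) (δ := δ) a x (-x) i
    have h0 : SkewPoly.opD σ δ a 0 i = 0 := by simp [SkewPoly.opD_apply]
    rw [add_neg_cancel, h0, congrFun hx i] at h
    rw [mul_neg]
    exact (neg_eq_of_add_eq_zero_right h.symm).symm
  mul_mem' := by
    intro x y hx hy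
    funext i
    rw [SkewPoly.opD_mul, ← mul_assoc, ← congrFun hx i, SkewPoly.opD_apply, add_mul,
      Finset.sum_mul]
    congr 1
    exact Finset.sum_congr rfl fun j _ => by rw [congrFun hy j, mul_assoc]
  inv_mem' := by
    intro x hx
    rcases eq_or_ne x 0 with rfl | h0
    · rw [inv_zero]
      exact hx
    funext i
    have h1 : ∀ i, (∑ j, σ x⁻¹ i j * (a j * x)) + δ.toAddMonoidHom x⁻¹ i * x = a i := by
      intro i
      have h := SkewPoly.opD_mul (σ := σ) (δ := δ) a x⁻¹ x i
      rw [inv_mul_cancel₀ h0, SkewPoly.opD_one] at h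
      rw [h]
      congr 1
      exact Finset.sum_congr rfl fun j _ => by rw [congrFun hx j]
    rw [← h1 i, SkewPoly.opD_apply, add_mul, Finset.sum_mul, mul_assoc _ x, mul_inv_cancel₀ h0,
      mul_one]
    congr 1
    exact Finset.sum_congr rfl fun j _ => by
      rw [mul_assoc, mul_assoc (a j), mul_inv_cancel₀ h0, mul_one]

end Conjugacy

section Weights

variable {F : Type*} [DivisionRing F]

/-- `F` as a right vector space over a division subring `K`. -/
instance rightModule (K : Subfield F) : Module (↥K)ᵐᵒᵖ F :=
  Module.compHom F (RingHom.op K.subtype)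

/-- The rank weight: the dimension over `K` of the right `K`-span of the entries. -/
noncomputable def rankWeight (K : Subfield F) {m : ℕ} (c : Fin m → F) : ℕ :=
  Module.finrank (↥K)ᵐᵒᵖ (Submodule.span (↥K)ᵐᵒᵖ (Set.range c))

/-- The sum-rank weight with lengths `m i` and division subrings `K i`. -/
noncomputable def sumRankWeight {ℓ : ℕ} (K : Fin ℓ → Subfield F) (m : Fin ℓ → ℕ)
    (c : (Σ i : Fin ℓ, Fin (m i)) → F) : ℕ :=
  ∑ i, rankWeight (K i) fun j : Fin (m i) => c ⟨i, j⟩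

variable {n : ℕ} (σ : F →+* Matrix (Fin n) (Fin n) F) (δ : SkewDerivation σ)

/-- The zeros of `P` in `Ω`. -/
def zerosIn (Ω : Set (Fin n → F)) (P : SkewPoly σ δ) : Set (Fin n → F) :=
  {a ∈ Ω | SkewPoly.eval P a = 0}

/-- The skew weight of a skew polynomial over `Ω`: `Rk(Ω) - Rk(Z_Ω(P))`, as an integer. -/
noncomputable def skewWeightPoly (Ω : Set (Fin n → F)) (P : SkewPoly σ δ) : ℤ :=
  (pRank σ δ Ω : ℤ) - (pRank σ δ (zerosIn σ δ Ω P) : ℤ)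

/-- `P` has degree less than the number of elements of `B` and takes the values `f` on `B`. -/
def Interpolates (B : Set (Fin n → F)) (f : B → F) (P : SkewPoly σ δ) : Prop :=
  P.degree < (B.ncard : WithBot ℕ) ∧ SkewPoly.evalOn σ δ B P = f

open Classical in
/-- The skew weight of `f : B → F`: the skew weight over the P-closure of `B` of a skew polynomial
of degree less than `|B|` with values `f` on `B`. Such polynomials exist, and they all have the same
skew weight, if `B` is finite and P-independent (the value is `0` if there are none). -/
noncomputable def skewWeight (B : Set (Fin n → F)) (f : B → F) : ℤ :=
  if h : ∃ P : SkewPoly σ δ, Interpolates σ δ B f P then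
    skewWeightPoly σ δ (pClosure σ δ B) h.choose
  else 0

/-- The skew Reed–Muller code of degree `d` at the points `b`. -/
def skewRMCode {ι : Type*} (d : ℕ) (b : ι → Fin n → F) : Set (ι → F) :=
  {c | ∃ P : SkewPoly σ δ, P.degree < (d : WithBot ℕ) ∧ c = fun p => SkewPoly.eval P (b p)}

/-- The linearized Reed–Muller code of degree `d` at the conjugacy representatives `a` and the
exponents `β`. -/
def linRMCode {ℓ : ℕ} {m : Fin ℓ → ℕ} (d : ℕ) (a : Fin ℓ → Fin n → F)
    (β : (i : Fin ℓ) → Fin (m i) → F) : Set ((Σ i : Fin ℓ, Fin (m i)) → F) :=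
  {c | ∃ P : SkewPoly σ δ, P.degree < (d : WithBot ℕ) ∧
    c = fun p => SkewPoly.linEval P (a p.1) (β p.1 p.2)}

end Weights

/-!
The identity `P^{D_a}(β) = P(a^β) β` makes evaluation at the conjugates of `a` right linear over the
centralizer `K_a`. So the exponents of the conjugates of `a` that lie in a P-closed set form, with
`0`, a right `K_a`-space. For the P-closure of a finite set `A`, this space is spanned by the
exponents of the points of `A`: if `A` is P-independent and `c` lies in its P-closure, then
`P(c) = ∑_b P(b) ψ_b` for fixed `ψ_b ∈ F`, and applying this to `xᵢ P` gives `c^{ψ_b} = b` whenever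
`ψ_b ≠ 0`. Hence conjugates with independent exponents are P-independent, and the rank of a P-closed
set is the sum of the dimensions of its exponent spaces. Passing to the zeros of `P` intersects the
exponent space at `aᵢ` with the kernel of `P^{D_{aᵢ}}`; by rank–nullity the rank drops by the
dimension of the span of the `P^{D_{aᵢ}}(βⱼ) = P(bⱼ) βⱼ`.

Interpolation in degree less than `|B|` holds because the values on `B` of the skew polynomials of
degree less than `d` form subspaces that grow strictly with `d` until they are stationary.
-/

section LinearAlgebra

variable {K V : Type*} [DivisionRing K] [AddCommGroup V] [Module K V]

theorem exists_linearIndependent_span_range_eq (W : Submodule K V) [Module.Finite K W] :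
    ∃ v : Fin (Module.finrank K W) → V,
      LinearIndependent K v ∧ Submodule.span K (Set.range v) = W := by
  refine ⟨W.subtype ∘ Module.finBasis K W, ?_, ?_⟩
  · exact (Module.finBasis K W).linearIndependent.map' W.subtype W.ker_subtype
  · rw [Set.range_comp, Submodule.span_image, Module.Basis.span_eq, Submodule.map_subtype_top]

theorem finrank_inf_ker_add_finrank_map {V' : Type*} [AddCommGroup V'] [Module K V']
    (L : V →ₗ[K] V') (W : Submodule K V) [Module.Finite K W] :
    Module.finrank K ↥(W ⊓ LinearMap.ker L) + Module.finrank K (W.map L) =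
      Module.finrank K W := by
  rw [← LinearMap.finrank_range_add_finrank_ker (L.domRestrict W), LinearMap.range_domRestrict,
    LinearMap.ker_domRestrict, add_comm, ← Submodule.map_comap_subtype,
    Submodule.finrank_map_subtype_eq]

end LinearAlgebra

namespace SkewPoly

variable {F : Type*} [DivisionRing F] {n : ℕ}
  {σ : F →+* Matrix (Fin n) (Fin n) F} {δ : SkewDerivation σ}

section Conjugates

theorem opD_conjugate_mul (a : Fin n → F) {β : F} (hβ : β ≠ 0) (γ : F) (i : Fin n) :
    opD σ δ (conjugate σ δ a β) γ i * β = opD σ δ a (γ * β) i := by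
  simp only [opD_mul, opD_apply (conjugate σ δ a β), conjugate, add_mul, Finset.sum_mul, mul_assoc,
    inv_mul_cancel₀ hβ, mul_one]

theorem opWord_conjugate_mul (a : Fin n → F) {β : F} (hβ : β ≠ 0) (γ : F)
    (m : FreeMonoid (Fin n)) :
    opWord σ δ (conjugate σ δ a β) m γ * β = opWord σ δ a m (γ * β) := by
  induction m using FreeMonoid.inductionOn' with
  | one => rfl
  | of_mul i m ih => rw [opWord_cons, opWord_cons, opD_conjugate_mul a hβ, ih]

theorem linEval_conjugate_mul (P : SkewPoly σ δ) (a : Fin n → F) {β : F} (hβ : β ≠ 0) (γ : F) :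
    linEval P (conjugate σ δ a β) γ * β = linEval P a (γ * β) := by
  simp only [linEval, lsum, smul_eq_mul, Finset.sum_mul, mul_assoc, opWord_conjugate_mul a hβ]

theorem eval_conjugate_mul (P : SkewPoly σ δ) (a : Fin n → F) {β : F} (hβ : β ≠ 0) :
    eval P (conjugate σ δ a β) * β = linEval P a β := by
  rw [eval_eq_linEval_one, linEval_conjugate_mul P a hβ, one_mul]

theorem eval_conjugate_eq_zero_iff (P : SkewPoly σ δ) (a : Fin n → F) {β : F} (hβ : β ≠ 0) :
    eval P (conjugate σ δ a β) = 0 ↔ linEval P a β = 0 := by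
  rw [← eval_conjugate_mul P a hβ, mul_eq_zero_iff_right hβ]

theorem conjugate_one (a : Fin n → F) : conjugate σ δ a 1 = a := by
  funext i
  rw [conjugate, opD_one, inv_one, mul_one]

theorem conjugate_conjugate (a : Fin n → F) {β : F} (hβ : β ≠ 0) (γ : F) :
    conjugate σ δ (conjugate σ δ a β) γ = conjugate σ δ a (γ * β) := by
  funext i
  rw [conjugate, conjugate, ← opD_conjugate_mul a hβ, mul_inv_rev, mul_assoc,
    mul_inv_cancel_left₀ hβ]

theorem conjugate_eq_iff {a c : Fin n → F} {β : F} (hβ : β ≠ 0) :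
    conjugate σ δ a β = c ↔ opD σ δ a β = fun i => c i * β := by
  simp only [funext_iff, conjugate, mul_inv_eq_iff_eq_mul₀ hβ]

theorem conjugate_eq_self_iff {a : Fin n → F} {β : F} (hβ : β ≠ 0) :
    conjugate σ δ a β = a ↔ β ∈ centralizerAt σ δ a :=
  conjugate_eq_iff hβ

theorem conjugate_eq_conjugate_iff {a c : Fin n → F} {β γ : F} (hβ : β ≠ 0) (hγ : γ ≠ 0) :
    conjugate σ δ a γ = conjugate σ δ c β ↔ conjugate σ δ a (β⁻¹ * γ) = c := by
  rw [← conjugate_conjugate a hγ]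
  constructor <;> intro h
  · rw [h, conjugate_conjugate c hβ, inv_mul_cancel₀ hβ, conjugate_one]
  · rw [← h, conjugate_conjugate _ (inv_ne_zero hβ), mul_inv_cancel₀ hβ, conjugate_one]

theorem op_smul_eq_mul (K : Subfield F) (k : (↥K)ᵐᵒᵖ) (x : F) : k • x = x * (k.unop : F) := rfl

/-- The linearized evaluation `P^{D_a}` as a right linear map over the centralizer of `a`. -/
noncomputable def linEvalHom (P : SkewPoly σ δ) (a : Fin n → F) :
    F →ₗ[(↥(centralizerAt σ δ a))ᵐᵒᵖ] F where
  toFun := linEval P a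
  map_add' β γ := by
    -- `P^{D_a}(β)` is the value at `a` of `P β`, which is additive in `β`.
    have h : ∀ x, linEval P a x = linEval (P * C x) a 1 := fun x => by
      rw [linEval_mul, linEval_C, mul_one]
    rw [h, C_add, mul_add, linEval_add, ← h, ← h]
  map_smul' k β := by
    simp only [op_smul_eq_mul, RingHom.id_apply]
    rcases eq_or_ne (k.unop : F) 0 with h0 | h0
    · rw [h0, mul_zero, mul_zero, linEval_zero_right]
    · rw [← linEval_conjugate_mul P a h0, (conjugate_eq_self_iff h0).mpr k.unop.2]

theorem linEvalHom_apply (P : SkewPoly σ δ) (a : Fin n → F) (β : F) :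
    linEvalHom P a β = linEval P a β := rfl

end Conjugates

section Evaluation

/-- Skew evaluation at a single point as a left linear functional. -/
noncomputable def evalHom (a : Fin n → F) : SkewPoly σ δ →ₗ[F] F :=
  LinearMap.proj ⟨a, rfl⟩ ∘ₗ evalOn σ δ {a}

theorem evalHom_apply (P : SkewPoly σ δ) (a : Fin n → F) : evalHom a P = eval P a := rfl

theorem evalOn_apply (B : Set (Fin n → F)) (P : SkewPoly σ δ) (b : B) :
    evalOn σ δ B P b = eval P b := rfl

theorem eval_one (a : Fin n → F) : eval (1 : SkewPoly σ δ) a = 1 := by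
  rw [eval_eq_linEval_one, one_def, linEval_monomial, one_mul]
  rfl

theorem eval_X_mul (i : Fin n) (P : SkewPoly σ δ) (a : Fin n → F) :
    eval (X i * P) a = opD σ δ a (eval P a) i := by
  rw [X_mul, eval_eq_linEval_one, eval_eq_linEval_one, opD_linEval]

end Evaluation

section Degree

theorem degree_lt_iff (P : SkewPoly σ δ) (d : ℕ) :
    P.degree < (d : WithBot ℕ) ↔ ∀ m, d ≤ FreeMonoid.length m → P.coeff m = 0 := by
  have hsupp : ∀ m, m ∈ P.support ↔ P.coeff m ≠ 0 := fun m => Finsupp.mem_support_iff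
  simp only [degree, Finset.sup_lt_iff (WithBot.bot_lt_coe d), hsupp, Nat.cast_withBot,
    WithBot.coe_lt_coe]
  exact forall_congr' fun m => by rw [← not_le, not_imp_not]

/-- The left vector space of skew polynomials of degree less than `d`. -/
noncomputable def degreeLT (σ : F →+* Matrix (Fin n) (Fin n) F) (δ : SkewDerivation σ) (d : ℕ) :
    Submodule F (SkewPoly σ δ) where
  carrier := {P | P.degree < (d : WithBot ℕ)}
  zero_mem' := (degree_lt_iff _ d).mpr fun _ _ => rfl
  add_mem' {P Q} hP hQ := (degree_lt_iff _ d).mpr fun m hm => by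
    change P.coeff m + Q.coeff m = 0
    rw [(degree_lt_iff P d).mp hP m hm, (degree_lt_iff Q d).mp hQ m hm, add_zero]
  smul_mem' c P hP := (degree_lt_iff _ d).mpr fun m hm => by
    change c * P.coeff m = 0
    rw [(degree_lt_iff P d).mp hP m hm, mul_zero]

theorem mem_degreeLT {d : ℕ} {P : SkewPoly σ δ} :
    P ∈ degreeLT σ δ d ↔ P.degree < (d : WithBot ℕ) := Iff.rfl

theorem degreeLT_mono : Monotone (degreeLT σ δ) :=
  fun _ _ hde _ hP =>
    mem_degreeLT.mpr (lt_of_lt_of_le (mem_degreeLT.mp hP) (Nat.cast_le.mpr hde))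

theorem monomial_mem_degreeLT {d : ℕ} {m : FreeMonoid (Fin n)} (hm : FreeMonoid.length m < d)
    (c : F) : monomial m c ∈ degreeLT σ δ d := by
  refine (degree_lt_iff _ d).mpr fun k hk => Finsupp.single_eq_of_ne ?_
  rintro rfl
  exact hk.not_gt hm

theorem sum_monomial_coeff (P : SkewPoly σ δ) :
    ∑ m ∈ P.support, monomial m (P.coeff m) = P := by
  simpa only [lsum, smul_monomial, mul_one] using lsum_one P

theorem X_mul_mem_degreeLT {d : ℕ} {P : SkewPoly σ δ} (hP : P ∈ degreeLT σ δ d) (i : Fin n) :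
    X i * P ∈ degreeLT σ δ (d + 1) := by
  rw [← sum_monomial_coeff P, Finset.mul_sum]
  refine Submodule.sum_mem _ fun m hm => ?_
  have hlen : FreeMonoid.length m < d := by
    by_contra! h
    exact Finsupp.mem_support_iff.mp hm ((degree_lt_iff P d).mp hP m h)
  rw [X_mul, varOp_monomial]
  refine add_mem (Submodule.sum_mem _ fun j _ => monomial_mem_degreeLT ?_ _)
    (monomial_mem_degreeLT (hlen.trans d.lt_succ_self) _)
  rw [FreeMonoid.length_mul, FreeMonoid.length_of]
  lia

end Degree

section Interpolation

variable {B : Set (Fin n → F)}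

theorem map_evalOn_degreeLT_eq_range_of_succ_le {d : ℕ}
    (h : (degreeLT σ δ (d + 1)).map (evalOn σ δ B) ≤ (degreeLT σ δ d).map (evalOn σ δ B)) :
    (degreeLT σ δ d).map (evalOn σ δ B) = LinearMap.range (evalOn σ δ B) := by
  refine le_antisymm LinearMap.map_le_range ?_
  rintro _ ⟨P, rfl⟩
  have hmonomial : ∀ m : FreeMonoid (Fin n),
      evalOn σ δ B (monomial m 1) ∈ (degreeLT σ δ d).map (evalOn σ δ B) := by
    intro m
    induction m using FreeMonoid.inductionOn' with
    | one => exact h ⟨_, monomial_mem_degreeLT d.succ_pos 1, rfl⟩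
    | of_mul i m ih =>
      obtain ⟨Q, hQ, hQm⟩ := ih
      -- The values of `xᵢ P` are determined by those of `P`, so `m` may be replaced by `Q`.
      refine h ⟨X i * Q, X_mul_mem_degreeLT hQ i, funext fun b => ?_⟩
      rw [evalOn_apply, evalOn_apply, ← varOp_monomial_one, ← X_mul, eval_X_mul, eval_X_mul]
      rw [← evalOn_apply B Q b, hQm, evalOn_apply]
  rw [← lsum_one P, lsum, map_sum]
  refine Submodule.sum_mem _ fun m _ => ?_
  rw [map_smul]
  exact Submodule.smul_mem _ _ (hmonomial m)

theorem map_evalOn_degreeLT_ncard_eq_range (hB : B.Finite) :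
    (degreeLT σ δ B.ncard).map (evalOn σ δ B) = LinearMap.range (evalOn σ δ B) := by
  have := hB.fintype
  set V : ℕ → Submodule F (B → F) := fun d => (degreeLT σ δ d).map (evalOn σ δ B)
  have hmono : Monotone V := fun d e hde => Submodule.map_mono (degreeLT_mono hde)
  have hrange : ∀ d, V d ≤ LinearMap.range (evalOn σ δ B) := fun d => LinearMap.map_le_range
  have hgrow : ∀ d, V d = LinearMap.range (evalOn σ δ B) ∨ d ≤ Module.finrank F (V d) := by
    intro d
    induction d with
    | zero => exact Or.inr (Nat.zero_le _)
    | succ d ih =>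
      rcases ih with htop | hdim
      · exact Or.inl ((hrange _).antisymm (htop ▸ hmono d.le_succ))
      · rcases (hmono d.le_succ).eq_or_lt with heq | hlt
        · exact Or.inl (heq ▸ map_evalOn_degreeLT_eq_range_of_succ_le heq.ge)
        · exact Or.inr (Nat.succ_le_of_lt (hdim.trans_lt (Submodule.finrank_lt_finrank_of_lt hlt)))
  refine (hgrow B.ncard).elim id fun hdim => (hrange _).antisymm ?_
  have hfull : V B.ncard = ⊤ := by
    refine Submodule.eq_top_of_finrank_eq (le_antisymm (Submodule.finrank_le _) ?_)
    rwa [Module.finrank_fintype_fun_eq_card, ← Nat.card_eq_fintype_card, Nat.card_coe_set_eq]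
  exact hfull ▸ le_top

end Interpolation

end SkewPoly

section Closure

variable {F : Type*} [DivisionRing F] {n : ℕ}
  {σ : F →+* Matrix (Fin n) (Fin n) F} {δ : SkewDerivation σ} {A B : Set (Fin n → F)}

theorem subset_pClosure (A : Set (Fin n → F)) : A ⊆ pClosure σ δ A :=
  fun a ha _ hP => hP a ha

theorem pClosure_subset_pClosure (h : A ⊆ pClosure σ δ B) : pClosure σ δ A ⊆ pClosure σ δ B :=
  fun _ hc P hP => hc P fun _ ha => h ha P hP

theorem pClosure_mono (h : A ⊆ B) : pClosure σ δ A ⊆ pClosure σ δ B :=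
  pClosure_subset_pClosure (h.trans (subset_pClosure B))

theorem notMem_pClosure_iff {c : Fin n → F} :
    c ∉ pClosure σ δ A ↔ ∃ P ∈ vanishing σ δ A, SkewPoly.eval P c ≠ 0 := by
  simp only [pClosure, zeroSet, Set.mem_ofPred_eq, not_forall, exists_prop, ne_eq]

theorem pClosure_zerosIn (A : Set (Fin n → F)) (P : SkewPoly σ δ) :
    pClosure σ δ (zerosIn σ δ (pClosure σ δ A) P) = zerosIn σ δ (pClosure σ δ A) P :=
  (subset_pClosure _).antisymm' fun _ hc =>
    ⟨pClosure_subset_pClosure (fun _ ha => ha.1) hc, hc P fun _ ha => ha.2⟩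

theorem PIndependent.insert (hA : PIndependent σ δ A) {c : Fin n → F} (hc : c ∉ pClosure σ δ A) :
    PIndependent σ δ (insert c A) := by
  rintro a (rfl | ha)
  · exact fun h => hc (pClosure_mono (by simp) h)
  obtain ⟨D, hD, hDa⟩ := notMem_pClosure_iff.mp (hA a ha)
  obtain ⟨Q, hQ, hQc⟩ := notMem_pClosure_iff.mp hc
  have heval : ∀ x, SkewPoly.eval (D - (SkewPoly.eval D c * (SkewPoly.eval Q c)⁻¹) • Q) x =
      SkewPoly.eval D x - SkewPoly.eval D c * (SkewPoly.eval Q c)⁻¹ * SkewPoly.eval Q x :=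
    fun x => by simp only [← SkewPoly.evalHom_apply, map_sub, map_smul, smul_eq_mul]
  refine notMem_pClosure_iff.mpr ⟨_, ?_, by rwa [heval, hQ a ha, mul_zero, sub_zero]⟩
  rintro x ⟨rfl | hx, hxa⟩
  · rw [heval, inv_mul_cancel_right₀ hQc, sub_self]
  · rw [heval, hD x ⟨hx, hxa⟩, hQ x hx, mul_zero, sub_zero]

theorem exists_pIndependent_subset_pClosure_eq (hA : A.Finite) :
    ∃ A' ⊆ A, PIndependent σ δ A' ∧ pClosure σ δ A' = pClosure σ δ A := by
  induction A, hA using Set.Finite.induction_on with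
  | empty => exact ⟨∅, subset_rfl, fun _ h => h.elim, rfl⟩
  | @insert c A _ _ ih =>
    obtain ⟨A', hsub, hind, hcl⟩ := ih
    have hA : A ⊆ pClosure σ δ A' := hcl ▸ subset_pClosure A
    by_cases hc : c ∈ pClosure σ δ A'
    · exact ⟨A', hsub.trans (Set.subset_insert c A), hind,
        (pClosure_mono (hsub.trans (Set.subset_insert c A))).antisymm
          (pClosure_subset_pClosure (Set.insert_subset hc hA))⟩
    · exact ⟨insert c A', Set.insert_subset_insert hsub, hind.insert hc,
        (pClosure_mono (Set.insert_subset_insert hsub)).antisymm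
          (pClosure_subset_pClosure (Set.insert_subset (subset_pClosure _ (Set.mem_insert c A'))
            (hA.trans (pClosure_mono (Set.subset_insert c A')))))⟩

theorem PIndependent.evalOn_surjective (hA : A.Finite) (hind : PIndependent σ δ A) :
    Function.Surjective (SkewPoly.evalOn σ δ A) := by
  lift A to Finset (Fin n → F) using hA
  exact _root_.evalOn_surjective hind

theorem PIndependent.exists_interpolates (hA : A.Finite) (hind : PIndependent σ δ A) (f : A → F) :
    ∃ P, Interpolates σ δ A f P := by
  have hf : f ∈ LinearMap.range (SkewPoly.evalOn σ δ A) := hind.evalOn_surjective hA f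
  rw [← SkewPoly.map_evalOn_degreeLT_ncard_eq_range hA] at hf
  exact hf

theorem PIndependent.exists_eval_eq_sum [Fintype A] (hind : PIndependent σ δ A)
    {c : Fin n → F} (hc : c ∈ pClosure σ δ A) :
    ∃ ψ : A → F, ∀ P : SkewPoly σ δ,
      SkewPoly.eval P c = ∑ b : A, SkewPoly.eval P b * ψ b := by
  classical
  obtain ⟨s, hs⟩ := (SkewPoly.evalOn σ δ A).exists_rightInverse_of_surjective
    (LinearMap.range_eq_top.mpr (hind.evalOn_surjective A.toFinite))
  have hs' : ∀ P b, SkewPoly.eval (s (SkewPoly.evalOn σ δ A P)) (b : A) = SkewPoly.eval P b :=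
    fun P b => congrFun (LinearMap.congr_fun hs (SkewPoly.evalOn σ δ A P)) b
  -- `P` and `s (P|_A)` agree on `A`, hence at `c`, so `P(c)` is a linear function of `P|_A`.
  have hc' : ∀ P, SkewPoly.eval P c = SkewPoly.eval (s (SkewPoly.evalOn σ δ A P)) c := fun P => by
    rw [← sub_eq_zero, ← SkewPoly.evalHom_apply, ← SkewPoly.evalHom_apply, ← map_sub]
    refine hc _ fun b hb => ?_
    rw [← SkewPoly.evalHom_apply, map_sub, SkewPoly.evalHom_apply, SkewPoly.evalHom_apply,
      hs' P ⟨b, hb⟩, sub_self]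
  refine ⟨fun b => SkewPoly.eval (s fun j => if b = j then 1 else 0) c, fun P => ?_⟩
  rw [hc' P]
  exact (SkewPoly.evalHom c ∘ₗ s).pi_apply_eq_sum_univ (SkewPoly.evalOn σ δ A P)

theorem PIndependent.conjugate_eq_of_eval_eq_sum [Fintype A] (hind : PIndependent σ δ A)
    {c : Fin n → F} {ψ : A → F}
    (hψ : ∀ P : SkewPoly σ δ, SkewPoly.eval P c = ∑ b : A, SkewPoly.eval P b * ψ b)
    {b : A} (hb : ψ b ≠ 0) : conjugate σ δ c (ψ b) = b := by
  classical
  obtain ⟨D, hD⟩ := hind.evalOn_surjective A.toFinite (Pi.single b 1)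
  have hD' : ∀ x : A, SkewPoly.eval D x = if x = b then 1 else 0 := fun x =>
    (congrFun hD x).trans (Pi.single_apply b 1 x)
  have hopD_zero : ∀ (x : Fin n → F) i, SkewPoly.opD σ δ x 0 i = 0 := fun x i => by
    simp only [SkewPoly.opD_apply, map_zero, Matrix.zero_apply, Pi.zero_apply, zero_mul,
      Finset.sum_const_zero, add_zero]
  have hDc : SkewPoly.eval D c = ψ b := by
    simp only [hψ D, hD', ite_mul, one_mul, zero_mul, Finset.sum_ite_eq', Finset.mem_univ, if_true]
  -- Evaluating `xᵢ D` at `c` in two ways gives `D_c(ψ b) = b (ψ b)`.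
  refine (SkewPoly.conjugate_eq_iff hb).mpr (funext fun i => ?_)
  rw [← hDc, ← SkewPoly.eval_X_mul, hψ, Finset.sum_eq_single b, SkewPoly.eval_X_mul, hD',
    if_pos rfl, SkewPoly.opD_one, hDc]
  · intro x _ hx
    rw [SkewPoly.eval_X_mul, hD', if_neg hx, hopD_zero, zero_mul]
  · exact fun h => (h (Finset.mem_univ b)).elim

end Closure

section ExponentSpace

variable {F : Type*} [DivisionRing F] {n : ℕ}
  (σ : F →+* Matrix (Fin n) (Fin n) F) (δ : SkewDerivation σ)

/-- The exponents of the conjugates of `a` that lie in `Ω`. -/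
def exponents (Ω : Set (Fin n → F)) (a : Fin n → F) : Set F :=
  {γ | γ ≠ 0 ∧ conjugate σ δ a γ ∈ Ω}

/-- The right `K_a`-space of the exponents, together with `0`, of the conjugates of `a` that lie in
the P-closure of `Ω`, defined as the common kernel of the operators `P^{D_a}` for the `P` that
vanish on `Ω`. -/
noncomputable def exponentSpace (Ω : Set (Fin n → F)) (a : Fin n → F) :
    Submodule (↥(centralizerAt σ δ a))ᵐᵒᵖ F :=
  ⨅ P ∈ vanishing σ δ Ω, LinearMap.ker (SkewPoly.linEvalHom P a)

variable {σ δ} {A Ω : Set (Fin n → F)} {a : Fin n → F} {γ : F}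

theorem mem_exponentSpace_iff (hγ : γ ≠ 0) :
    γ ∈ exponentSpace σ δ Ω a ↔ conjugate σ δ a γ ∈ pClosure σ δ Ω := by
  simp only [exponentSpace, Submodule.mem_iInf, LinearMap.mem_ker, SkewPoly.linEvalHom_apply,
    ← SkewPoly.eval_conjugate_eq_zero_iff _ a hγ]
  rfl

theorem exponentSpace_zerosIn (A : Set (Fin n → F)) (a : Fin n → F) (P : SkewPoly σ δ) :
    exponentSpace σ δ (zerosIn σ δ (pClosure σ δ A) P) a =
      exponentSpace σ δ A a ⊓ LinearMap.ker (SkewPoly.linEvalHom P a) := by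
  ext γ
  rcases eq_or_ne γ 0 with rfl | hγ
  · simp only [zero_mem]
  · rw [Submodule.mem_inf, mem_exponentSpace_iff hγ, mem_exponentSpace_iff hγ, pClosure_zerosIn,
      LinearMap.mem_ker, SkewPoly.linEvalHom_apply, ← SkewPoly.eval_conjugate_eq_zero_iff P a hγ]
    rfl

theorem exponentSpace_eq_span_exponents (hA : A.Finite) (a : Fin n → F) :
    exponentSpace σ δ A a = Submodule.span _ (exponents σ δ A a) := by
  refine le_antisymm (fun γ hγ => ?_) (Submodule.span_le.mpr fun γ hγ =>
    (mem_exponentSpace_iff hγ.1).mpr (subset_pClosure A hγ.2))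
  rcases eq_or_ne γ 0 with rfl | hγ0
  · exact zero_mem _
  obtain ⟨A', hsub, hind, hcl⟩ := exists_pIndependent_subset_pClosure_eq (σ := σ) (δ := δ) hA
  have := (hA.subset hsub).fintype
  rw [mem_exponentSpace_iff hγ0, ← hcl] at hγ
  obtain ⟨ψ, hψ⟩ := hind.exists_eval_eq_sum hγ
  have hsum : ∑ b, ψ b * γ = γ := by
    have h := hψ 1
    simp only [SkewPoly.eval_one, one_mul] at h
    rw [← Finset.sum_mul, ← h, one_mul]
  rw [← hsum]
  refine Submodule.sum_mem _ fun b _ => ?_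
  rcases eq_or_ne (ψ b) 0 with h0 | h0
  · rw [h0, zero_mul]
    exact zero_mem _
  · refine Submodule.subset_span ⟨mul_ne_zero h0 hγ0, ?_⟩
    rw [← SkewPoly.conjugate_conjugate a hγ0, hind.conjugate_eq_of_eval_eq_sum hψ h0]
    exact hsub b.2

theorem exponents_nonempty_of_mem_pClosure (hA : A.Finite) {c : Fin n → F}
    (hc : c ∈ pClosure σ δ A) : (exponents σ δ A c).Nonempty := by
  by_contra! hempty
  have hone : (1 : F) ∈ exponentSpace σ δ A c := by
    rwa [mem_exponentSpace_iff one_ne_zero, SkewPoly.conjugate_one]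
  rw [exponentSpace_eq_span_exponents hA, hempty, Submodule.span_empty] at hone
  exact one_ne_zero hone

end ExponentSpace

section Rank

variable {F : Type*} [DivisionRing F] {n : ℕ}
  (σ : F →+* Matrix (Fin n) (Fin n) F) (δ : SkewDerivation σ)
  {ι : Type*} {κ : ι → Type*}

/-- The conjugates of the points `a i` with exponents `β i j`. -/
def conjugateFamily (a : ι → Fin n → F) (β : ∀ i, κ i → F) (p : Σ i, κ i) : Fin n → F :=
  conjugate σ δ (a p.1) (β p.1 p.2)

variable {σ δ} {a : ι → Fin n → F} {β : ∀ i, κ i → F}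

theorem exponentSpace_image_conjugateFamily (ha : Pairwise fun i k => ¬ IsConjugate σ δ (a i) (a k))
    (hβ : ∀ i j, β i j ≠ 0) {S : Set (Σ i, κ i)} (hS : S.Finite) (i : ι) :
    exponentSpace σ δ (conjugateFamily σ δ a β '' S) (a i) =
      Submodule.span _ (β i '' (Sigma.mk i ⁻¹' S)) := by
  rw [exponentSpace_eq_span_exponents (hS.image _)]
  refine le_antisymm (Submodule.span_le.mpr ?_) (Submodule.span_mono ?_)
  · rintro γ ⟨hγ, ⟨k, j⟩, hkj, h⟩
    have hk := (SkewPoly.conjugate_eq_conjugate_iff (hβ k j) hγ).mp h.symm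
    have hne : (β k j)⁻¹ * γ ≠ 0 := mul_ne_zero (inv_ne_zero (hβ k j)) hγ
    obtain rfl : i = k := ha.eq (not_not.mpr ⟨_, hne, hk.symm⟩)
    have hmem := Submodule.smul_mem (Submodule.span _ (β i '' (Sigma.mk i ⁻¹' S)))
      (MulOpposite.op (⟨_, (SkewPoly.conjugate_eq_self_iff hne).mp hk⟩ : centralizerAt σ δ (a i)))
      (Submodule.subset_span ⟨j, hkj, rfl⟩)
    rwa [SkewPoly.op_smul_eq_mul, MulOpposite.unop_op, mul_inv_cancel_left₀ (hβ i j)] at hmem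
  · rintro _ ⟨j, hj, rfl⟩
    exact ⟨hβ i j, ⟨i, j⟩, hj, rfl⟩

theorem exponentSpace_range_conjugateFamily [Finite (Σ i, κ i)]
    (ha : Pairwise fun i k => ¬ IsConjugate σ δ (a i) (a k)) (hβ : ∀ i j, β i j ≠ 0) (i : ι) :
    exponentSpace σ δ (Set.range (conjugateFamily σ δ a β)) (a i) =
      Submodule.span _ (Set.range (β i)) := by
  rw [← Set.image_univ, exponentSpace_image_conjugateFamily ha hβ Set.finite_univ,
    Set.preimage_univ, Set.image_univ]

theorem conjugateFamily_notMem_pClosure_image_compl [Finite (Σ i, κ i)]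
    (ha : Pairwise fun i k => ¬ IsConjugate σ δ (a i) (a k))
    (hβ : ∀ i, LinearIndependent (↥(centralizerAt σ δ (a i)))ᵐᵒᵖ (β i)) (p : Σ i, κ i) :
    conjugateFamily σ δ a β p ∉ pClosure σ δ (conjugateFamily σ δ a β '' {p}ᶜ) := by
  obtain ⟨i, j⟩ := p
  have hne : ∀ i j, β i j ≠ 0 := fun i => (hβ i).ne_zero
  rw [conjugateFamily, ← mem_exponentSpace_iff (hne i j),
    exponentSpace_image_conjugateFamily ha hne (Set.toFinite _)]
  exact (hβ i).notMem_span_image fun h => h rfl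

theorem conjugateFamily_injective_of_linearIndependent [Finite (Σ i, κ i)]
    (ha : Pairwise fun i k => ¬ IsConjugate σ δ (a i) (a k))
    (hβ : ∀ i, LinearIndependent (↥(centralizerAt σ δ (a i)))ᵐᵒᵖ (β i)) :
    Function.Injective (conjugateFamily σ δ a β) := by
  intro p q hpq
  by_contra hne
  exact conjugateFamily_notMem_pClosure_image_compl ha hβ p
    (subset_pClosure _ ⟨q, Ne.symm hne, hpq.symm⟩)

theorem pIndependent_range_conjugateFamily [Finite (Σ i, κ i)]
    (ha : Pairwise fun i k => ¬ IsConjugate σ δ (a i) (a k))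
    (hβ : ∀ i, LinearIndependent (↥(centralizerAt σ δ (a i)))ᵐᵒᵖ (β i)) :
    PIndependent σ δ (Set.range (conjugateFamily σ δ a β)) := by
  rintro _ ⟨p, rfl⟩ h
  refine conjugateFamily_notMem_pClosure_image_compl ha hβ p (pClosure_mono ?_ h)
  rintro _ ⟨⟨q, rfl⟩, hq⟩
  exact ⟨q, fun hqp => hq (congrArg _ hqp), rfl⟩

theorem exists_isPBasis_card_eq_sum_finrank [Fintype ι]
    (ha : Pairwise fun i k => ¬ IsConjugate σ δ (a i) (a k)) {Ω : Set (Fin n → F)}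
    (hΩ : ∀ c ∈ pClosure σ δ Ω, ∃ i, IsConjugate σ δ (a i) c)
    [∀ i, Module.Finite (↥(centralizerAt σ δ (a i)))ᵐᵒᵖ (exponentSpace σ δ Ω (a i))] :
    ∃ Z : Finset (Fin n → F), IsPBasis σ δ (Z : Set (Fin n → F)) (pClosure σ δ Ω) ∧
      Z.card = ∑ i, Module.finrank (↥(centralizerAt σ δ (a i)))ᵐᵒᵖ
        (exponentSpace σ δ Ω (a i)) := by
  classical
  choose γ hγ hγspan using fun i => exists_linearIndependent_span_range_eq
    (exponentSpace σ δ Ω (a i))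
  have hne : ∀ i j, γ i j ≠ 0 := fun i => (hγ i).ne_zero
  have hspan : ∀ i, exponentSpace σ δ (Set.range (conjugateFamily σ δ a γ)) (a i) =
      exponentSpace σ δ Ω (a i) := fun i => by
    rw [exponentSpace_range_conjugateFamily ha hne, hγspan]
  have hsub : Set.range (conjugateFamily σ δ a γ) ⊆ pClosure σ δ Ω := by
    rintro _ ⟨⟨i, j⟩, rfl⟩
    refine (mem_exponentSpace_iff (hne i j)).mp ?_
    rw [← hγspan]
    exact Submodule.subset_span (Set.mem_range_self j)
  have hclosure : pClosure σ δ (Set.range (conjugateFamily σ δ a γ)) = pClosure σ δ Ω := by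
    refine (pClosure_subset_pClosure hsub).antisymm fun c hc => ?_
    obtain ⟨i, ε, hε, rfl⟩ := hΩ c hc
    rwa [← mem_exponentSpace_iff hε, hspan, mem_exponentSpace_iff hε]
  refine ⟨Finset.univ.image (conjugateFamily σ δ a γ), ?_, ?_⟩
  · rw [Finset.coe_image, Finset.coe_univ, Set.image_univ]
    exact ⟨hsub, pIndependent_range_conjugateFamily ha hγ, hclosure⟩
  · rw [Finset.card_image_of_injective _ (conjugateFamily_injective_of_linearIndependent ha hγ),
      Finset.card_univ, Fintype.card_sigma]
    simp only [Fintype.card_fin]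

theorem exists_isConjugate_of_mem_pClosure_range_conjugateFamily [Finite (Σ i, κ i)]
    (hβ : ∀ i j, β i j ≠ 0) {c : Fin n → F}
    (hc : c ∈ pClosure σ δ (Set.range (conjugateFamily σ δ a β))) :
    ∃ i, IsConjugate σ δ (a i) c := by
  obtain ⟨γ, hγ, ⟨i, j⟩, h⟩ := exponents_nonempty_of_mem_pClosure (Set.finite_range _) hc
  exact ⟨i, _, mul_ne_zero (inv_ne_zero hγ) (hβ i j),
    ((SkewPoly.conjugate_eq_conjugate_iff hγ (hβ i j)).mp h).symm⟩

end Rank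

section Weight

variable {F : Type*} [DivisionRing F] {n : ℕ}
  {σ : F →+* Matrix (Fin n) (Fin n) F} {δ : SkewDerivation σ}

theorem rankWeight_comp {K : Subfield F} {m : ℕ} (L : F →ₗ[(↥K)ᵐᵒᵖ] F) (v : Fin m → F) :
    rankWeight K (L ∘ v) =
      Module.finrank (↥K)ᵐᵒᵖ ((Submodule.span (↥K)ᵐᵒᵖ (Set.range v)).map L) := by
  rw [rankWeight, Set.range_comp, Submodule.map_span]

theorem exists_isPBasis_and_skewWeightPoly_eq {ℓ : ℕ} {M : Fin ℓ → ℕ} {a : Fin ℓ → Fin n → F}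
    (ha : Pairwise fun i k => ¬ IsConjugate σ δ (a i) (a k)) {β : (i : Fin ℓ) → Fin (M i) → F}
    (hβ : ∀ i j, β i j ≠ 0) (P : SkewPoly σ δ) :
    (∃ Z : Finset (Fin n → F), IsPBasis σ δ (Z : Set (Fin n → F))
      (zerosIn σ δ (pClosure σ δ (Set.range (conjugateFamily σ δ a β))) P)) ∧
    skewWeightPoly σ δ (pClosure σ δ (Set.range (conjugateFamily σ δ a β))) P =
      (sumRankWeight (fun i => centralizerAt σ δ (a i)) M
        (fun p => SkewPoly.eval P (conjugateFamily σ δ a β p) * β p.1 p.2) : ℤ) := by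
  set B := Set.range (conjugateFamily σ δ a β)
  have hspan : ∀ i, exponentSpace σ δ B (a i) = Submodule.span _ (Set.range (β i)) :=
    exponentSpace_range_conjugateFamily ha hβ
  have hfinite : ∀ i, Module.Finite (↥(centralizerAt σ δ (a i)))ᵐᵒᵖ (exponentSpace σ δ B (a i)) :=
    fun i => by
      rw [hspan]
      exact FiniteDimensional.span_of_finite _ (Set.finite_range _)
  have hfinite' : ∀ i, Module.Finite (↥(centralizerAt σ δ (a i)))ᵐᵒᵖ
      (exponentSpace σ δ (zerosIn σ δ (pClosure σ δ B) P) (a i)) := fun i => by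
    rw [exponentSpace_zerosIn]
    infer_instance
  have hconj : ∀ c ∈ pClosure σ δ B, ∃ i, IsConjugate σ δ (a i) c := fun _ =>
    exists_isConjugate_of_mem_pClosure_range_conjugateFamily hβ
  obtain ⟨Y, hY, hYcard⟩ := exists_isPBasis_card_eq_sum_finrank ha hconj
  obtain ⟨Z, hZ, hZcard⟩ := exists_isPBasis_card_eq_sum_finrank ha
    (Ω := zerosIn σ δ (pClosure σ δ B) P) fun c hc => hconj c (pClosure_zerosIn B P ▸ hc).1
  rw [pClosure_zerosIn] at hZ
  refine ⟨⟨Z, hZ⟩, ?_⟩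
  have hnullity : ∀ i, Module.finrank (↥(centralizerAt σ δ (a i)))ᵐᵒᵖ (exponentSpace σ δ B (a i)) =
      Module.finrank (↥(centralizerAt σ δ (a i)))ᵐᵒᵖ
        (exponentSpace σ δ (zerosIn σ δ (pClosure σ δ B) P) (a i)) +
      rankWeight (centralizerAt σ δ (a i))
        (fun j => SkewPoly.eval P (conjugateFamily σ δ a β ⟨i, j⟩) * β i j) := fun i => by
    simp only [conjugateFamily, SkewPoly.eval_conjugate_mul P _ (hβ i _)]
    rw [exponentSpace_zerosIn, ← finrank_inf_ker_add_finrank_map (SkewPoly.linEvalHom P (a i)),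
      hspan, ← rankWeight_comp]
    rfl
  rw [skewWeightPoly, pRank_eq hY, pRank_eq hZ, hYcard, hZcard, sub_eq_iff_eq_add', sumRankWeight,
    Finset.sum_congr rfl fun i _ => hnullity i, Finset.sum_add_distrib, Nat.cast_add]

theorem skewWeight_eq {B : Set (Fin n → F)} {f : B → F} {w : ℤ}
    (hex : ∃ P : SkewPoly σ δ, Interpolates σ δ B f P)
    (hw : ∀ P : SkewPoly σ δ, Interpolates σ δ B f P →
      skewWeightPoly σ δ (pClosure σ δ B) P = w) :
    skewWeight σ δ B f = w := by
  rw [skewWeight, dif_pos hex]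
  exact hw _ hex.choose_spec

theorem linRMCode_eq_image_skewRMCode {ℓ : ℕ} {M : Fin ℓ → ℕ} (a : Fin ℓ → Fin n → F)
    {β : (i : Fin ℓ) → Fin (M i) → F} (hβ : ∀ i j, β i j ≠ 0) (d : ℕ) :
    linRMCode σ δ d a β = (fun (c : (Σ i : Fin ℓ, Fin (M i)) → F) p => c p * β p.1 p.2) ''
      skewRMCode σ δ d (conjugateFamily σ δ a β) := by
  have hscale : ∀ P : SkewPoly σ δ,
      (fun p : Σ i, Fin (M i) => SkewPoly.linEval P (a p.1) (β p.1 p.2)) = fun p =>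
        SkewPoly.eval P (conjugateFamily σ δ a β p) * β p.1 p.2 := fun P =>
    funext fun p => (SkewPoly.eval_conjugate_mul P (a p.1) (hβ p.1 p.2)).symm
  ext c
  constructor
  · rintro ⟨P, hP, rfl⟩
    exact ⟨_, ⟨P, hP, rfl⟩, (hscale P).symm⟩
  · rintro ⟨_, ⟨P, hP, rfl⟩, rfl⟩
    exact ⟨P, hP, (hscale P).symm⟩

end Weight

theorem mainTheorem12_general {F : Type*} [DivisionRing F] {n : ℕ}
    (σ : F →+* Matrix (Fin n) (Fin n) F) (δ : SkewDerivation σ)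
    {ℓ : ℕ} (M : Fin ℓ → ℕ) (a : Fin ℓ → Fin n → F)
    (ha : Pairwise fun i k => ¬ IsConjugate σ δ (a i) (a k))
    (β : (i : Fin ℓ) → Fin (M i) → F) (hβ : ∀ i j, β i j ≠ 0)
    (b : (Σ i : Fin ℓ, Fin (M i)) → Fin n → F)
    (hb : ∀ i j, b ⟨i, j⟩ = conjugate σ δ (a i) (β i j))
    (hind : PIndependent σ δ (Set.range b)) :
    (∀ f : Set.range b → F,
      (∃ P : SkewPoly σ δ, Interpolates σ δ (Set.range b) f P) ∧
      (∀ P : SkewPoly σ δ, SkewPoly.evalOn σ δ (Set.range b) P = f →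
        (∃ Z : Finset (Fin n → F),
          IsPBasis σ δ (Z : Set (Fin n → F)) (zerosIn σ δ (pClosure σ δ (Set.range b)) P)) ∧
        skewWeightPoly σ δ (pClosure σ δ (Set.range b)) P =
          (sumRankWeight (fun i => centralizerAt σ δ (a i)) M
            (fun p => f ⟨b p, Set.mem_range_self p⟩ * β p.1 p.2) : ℤ)) ∧
      skewWeight σ δ (Set.range b) f =
        (sumRankWeight (fun i => centralizerAt σ δ (a i)) M
          (fun p => f ⟨b p, Set.mem_range_self p⟩ * β p.1 p.2) : ℤ)) ∧
    (∀ d : ℕ, linRMCode σ δ d a β =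
      (fun (c : (Σ i : Fin ℓ, Fin (M i)) → F) p => c p * β p.1 p.2) '' skewRMCode σ δ d b) := by
  obtain rfl : b = conjugateFamily σ δ a β := funext fun p => hb p.1 p.2
  refine ⟨fun f => ?_, linRMCode_eq_image_skewRMCode a hβ⟩
  have hex := hind.exists_interpolates (Set.finite_range _) f
  refine ⟨hex, ?_, skewWeight_eq hex ?_⟩
  · rintro P rfl
    exact exists_isPBasis_and_skewWeightPoly_eq ha hβ P
  · rintro P ⟨-, rfl⟩
    exact (exists_isPBasis_and_skewWeightPoly_eq ha hβ P).2

theorem mainTheorem12 {F : Type*} [DivisionRing F] {n : ℕ}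
    (σ : F →+* Matrix (Fin n) (Fin n) F) (δ : SkewDerivation σ)
    {ℓ : ℕ} (M : Fin ℓ → ℕ) (a : Fin ℓ → Fin n → F)
    (ha : Pairwise fun i k => ¬ IsConjugate σ δ (a i) (a k))
    (β : (i : Fin ℓ) → Fin (M i) → F) (hβ : ∀ i j, β i j ≠ 0)
    (b : (Σ i : Fin ℓ, Fin (M i)) → Fin n → F)
    (hb : ∀ i j, b ⟨i, j⟩ = conjugate σ δ (a i) (β i j))
    (hinj : Function.Injective b) (hind : PIndependent σ δ (Set.range b)) :
    (∀ f : Set.range b → F,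
      (∃ P : SkewPoly σ δ, Interpolates σ δ (Set.range b) f P) ∧
      (∀ P : SkewPoly σ δ, Interpolates σ δ (Set.range b) f P →
        (∃ Z : Finset (Fin n → F),
          IsPBasis σ δ (Z : Set (Fin n → F)) (zerosIn σ δ (pClosure σ δ (Set.range b)) P)) ∧
        skewWeightPoly σ δ (pClosure σ δ (Set.range b)) P =
          (sumRankWeight (fun i => centralizerAt σ δ (a i)) M
            (fun p => f ⟨b p, Set.mem_range_self p⟩ * β p.1 p.2) : ℤ)) ∧
      skewWeight σ δ (Set.range b) f =
        (sumRankWeight (fun i => centralizerAt σ δ (a i)) M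
          (fun p => f ⟨b p, Set.mem_range_self p⟩ * β p.1 p.2) : ℤ)) ∧
    (∀ d : ℕ, linRMCode σ δ d a β =
      (fun (c : (Σ i : Fin ℓ, Fin (M i)) → F) p => c p * β p.1 p.2) '' skewRMCode σ δ d b) := by
  obtain ⟨hweight, hcode⟩ := mainTheorem12_general σ δ M a ha β hβ b hb hind
  exact ⟨fun f => ⟨(hweight f).1, fun P hP => (hweight f).2.1 P hP.2, (hweight f).2.2⟩, hcode⟩
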